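/- **Theorem (uniqueness and continuous dependence).** Let $1\le d\le 3$, and let $\Omega$ be either a bounded Lipschitz domain in $\mathbb R^d$ or a flat torus $\mathbb R^d/\Lambda$ ($\Lambda$ a lattice of full rank). Let $\kappa>0$, $\Gamma>0$, $a_2,a_4,h\in\mathbb R$, $a_6>0$, and let $V(s)=a_2s^2+a_4s^4+a_6s^6-hs$ (so that $V''$ is locally Lipschitz with polynomial growth). Consider the $L^2$-gradient flow $$\partial_t\sigma=\Gamma\big(\kappa\Delta\sigma-V'(\sigma)\big),\qquad \sigma(0)=\sigma_0\in L^2(\Omega),$$ with one of the following boundary conditions. On a bounded Lipschitz domain: Dirichlet with prescribed trace $\bar\sigma$ (admissible set $\mathcal V_{\bar\sigma}=\{u\in H^1(\Omega):u|_{\partial\Omega}=\bar\sigma\}$, test space $\mathcal V_0=H^1_0(\Omega)$), or homogeneous Neumann (admissible set and test space $\mathcal V_0=H^1(\Omega)$). On a flat torus: periodic (admissible set and test space $\mathcal V_0=H^1(\Omega)$). A weak solution is a function $\sigma\in C([0,\infty);L^2(\Omega))\cap L^2_{\rm loc}(0,\infty;H^1(\Omega))$ with $\partial_t\sigma\in L^2_{\rm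 loc}(0,\infty;\mathcal V_0^*)$ and $\sigma(0)=\sigma_0$, such that for a.e. $t>0$ the function $\sigma(t)$ is admissible and, for all $\varphi\in\mathcal V_0$, $$\langle\partial_t\sigma(t),\varphi\rangle=-\Gamma\int_\Omega\big(\kappa\nabla\sigma(t)\cdot\nabla\varphi+V'(\sigma(t))\varphi\big)\,dx .$$ Then there is a constant $C\ge0$, depending only on $\Omega,\kappa,\Gamma,a_2,a_4,a_6,h$, such that, for any of the boundary conditions available on $\Omega$, any two weak solutions $\sigma_1,\sigma_2$ with that boundary condition and initial data $\sigma_{0,1},\sigma_{0,2}\in L^2(\Omega)$ satisfy, for every $t\ge0$, $$\|\sigma_1(t)-\sigma_2(t)\|_{2}^2\le\exp\Big(C\int_0^t\big(1+\|\sigma_1(s)\|_{6}^4+\|\sigma_2(s)\|_{6}^4\big)\,ds\Big)\,\|\sigma_{0,1}-\sigma_{0,2}\|_{2}^2 ,$$ where the integral takes values in $[0,\infty]$ and $0\cdot\infty=0$. In particular, weak solutions are unique: two weak solutions with the same boundary condition and the same initial datum coincide at every $t\ge0$. -/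

import Mathlib

open MeasureTheory Set Filter Topology
open scoped NNReal ENNReal ContDiff

noncomputable section

namespace LandauFlow

/-- Euclidean space `ℝ^d`. -/
abbrev E (d : ℕ) : Type := EuclideanSpace ℝ (Fin d)

/-- The sextic Landau potential `V(s) = a₂ s² + a₄ s⁴ + a₆ s⁶ - h s`. -/
def landauPotential (a₂ a₄ a₆ h : ℝ) (s : ℝ) : ℝ :=
  a₂ * s ^ 2 + a₄ * s ^ 4 + a₆ * s ^ 6 - h * s

/-- Bounded Lipschitz domain: a bounded, nonempty, connected open set which near each of its
boundary points is the strict epigraph, in the direction of some unit vector `e`, of a Lipschitz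
function `γ` of the coordinates orthogonal to `e`. -/
structure IsBoundedLipschitzDomain {d : ℕ} (Ω : Set (E d)) : Prop where
  isOpen : IsOpen Ω
  isConnected : IsConnected Ω
  isBounded : Bornology.IsBounded Ω
  locally_epigraph : ∀ x ∈ frontier Ω, ∃ (e : E d) (r : ℝ) (K : ℝ≥0) (γ : E d → ℝ),
    ‖e‖ = 1 ∧ 0 < r ∧ LipschitzWith K γ ∧ (∀ (y : E d) (s : ℝ), γ (y + s • e) = γ y) ∧
    ∀ y ∈ Metric.ball x r, y ∈ Ω ↔ γ y < inner ℝ y e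

/-- The spatial domain: a bounded Lipschitz domain of `ℝ^d`, or the flat torus `ℝ^d / Λ`, where
`Λ` is the lattice spanned by a basis `b` of `ℝ^d`. -/
inductive SpatialDomain (d : ℕ) : Type
  | lipschitz (Ω : Set (E d)) (hΩ : IsBoundedLipschitzDomain Ω) : SpatialDomain d
  | torus (b : Module.Basis (Fin d) ℝ (E d)) : SpatialDomain d

namespace SpatialDomain

variable {d : ℕ}

/-- The set of `ℝ^d` on which the functions live; the torus is represented by the fundamental
parallelepiped of its lattice. -/
def region : SpatialDomain d → Set (E d)
  | lipschitz Ω _ => Ω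
  | torus b => ZSpan.fundamentalDomain b

/-- Lebesgue measure on the domain. -/
def measure (S : SpatialDomain d) : Measure (E d) := volume.restrict S.region

/-- Smooth test functions: compactly supported in `Ω` for a domain, lattice periodic for a torus. -/
def testFunctions : SpatialDomain d → Set (E d → ℝ)
  | lipschitz Ω _ => {ψ | ContDiff ℝ ∞ ψ ∧ HasCompactSupport ψ ∧ tsupport ψ ⊆ Ω}
  | torus b => {ψ | ContDiff ℝ ∞ ψ ∧ ∀ (i : Fin d) (x : E d), ψ (x + b i) = ψ x}

/-- `H = L²(Ω)`. -/
abbrev L2 (S : SpatialDomain d) : Type := Lp ℝ 2 S.measure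

/-- `L²(Ω) × L²(Ω; ℝ^d)` with the Hilbert norm `(‖u‖² + ‖G‖²)^{1/2}`. A function `u ∈ H¹(Ω)` is
represented by the pair `(u, ∇u)`, so that this norm is the `H¹` norm. -/
abbrev L2Pair (S : SpatialDomain d) : Type := WithLp 2 (Lp ℝ 2 S.measure × Lp (E d) 2 S.measure)

theorem contDiff_of_mem {S : SpatialDomain d} {ψ : E d → ℝ} (h : ψ ∈ S.testFunctions) :
    ContDiff ℝ ∞ ψ := by
  cases S with
  | lipschitz Ω hΩ => exact h.1
  | torus b => exact h.1

theorem isBounded_region (S : SpatialDomain d) : Bornology.IsBounded S.region := by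
  cases S with
  | lipschitz Ω hΩ => exact hΩ.isBounded
  | torus b => exact ZSpan.fundamentalDomain_isBounded b

theorem memLp_of_continuous (S : SpatialDomain d) {f : E d → ℝ} (hf : Continuous f) :
    MemLp f 2 S.measure := by
  have hc : IsCompact (closure S.region) := S.isBounded_region.isCompact_closure
  obtain ⟨M, hM⟩ := hc.exists_bound_of_continuousOn hf.continuousOn
  have : IsFiniteMeasure S.measure :=
    ⟨by simpa [measure] using S.isBounded_region.measure_lt_top⟩
  refine MemLp.of_bound hf.aestronglyMeasurable M ?_
  have h : ∀ᵐ x ∂(volume.restrict (closure S.region)), ‖f x‖ ≤ M :=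
    ae_restrict_of_forall_mem isClosed_closure.measurableSet hM
  exact ae_mono (Measure.restrict_mono subset_closure le_rfl) h

theorem integrable_fst (S : SpatialDomain d) (p : S.L2Pair) {ψ : E d → ℝ}
    (h : ψ ∈ S.testFunctions) (i : Fin d) :
    Integrable (fun x => p.fst x * fderiv ℝ ψ x (EuclideanSpace.single i 1)) S.measure :=
  (Lp.memLp p.fst).integrable_mul (S.memLp_of_continuous
    (((contDiff_of_mem h).continuous_fderiv (by simp)).clm_apply continuous_const))

theorem integrable_snd (S : SpatialDomain d) (p : S.L2Pair) {ψ : E d → ℝ}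
    (h : ψ ∈ S.testFunctions) (i : Fin d) :
    Integrable (fun x => p.snd x i * ψ x) S.measure :=
  ((EuclideanSpace.proj (𝕜 := ℝ) i).comp_memLp' (Lp.memLp p.snd)).integrable_mul
    (S.memLp_of_continuous (contDiff_of_mem h).continuous)

/-- `H¹(Ω)`: the pairs `(u, G)` of square integrable functions such that `G` is the weak gradient
of `u`, that is `∫ u ∂ᵢψ = - ∫ Gᵢ ψ` for all test functions `ψ` and all `i`. -/
def H1 (S : SpatialDomain d) : Submodule ℝ S.L2Pair where
  carrier := {p | ∀ ψ ∈ S.testFunctions, ∀ i : Fin d,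
    ∫ x, p.fst x * fderiv ℝ ψ x (EuclideanSpace.single i 1) ∂S.measure =
      - ∫ x, p.snd x i * ψ x ∂S.measure}
  zero_mem' := by
    intro ψ hψ i
    have h1 : ∀ᵐ x ∂S.measure, (0 : S.L2Pair).fst x = 0 := Lp.coeFn_zero _ _ _
    have h2 : ∀ᵐ x ∂S.measure, (0 : S.L2Pair).snd x = 0 := Lp.coeFn_zero _ _ _
    rw [integral_eq_zero_of_ae (by filter_upwards [h1] with x hx; change _ * _ = (0 : ℝ); rw [hx]; simp),
      integral_eq_zero_of_ae (by filter_upwards [h2] with x hx; change _ * _ = (0 : ℝ); rw [hx]; simp), neg_zero]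
  add_mem' := by
    intro p q hp hq ψ hψ i
    have h1 : ∀ᵐ x ∂S.measure, (p + q).fst x = p.fst x + q.fst x := Lp.coeFn_add _ _
    have h2 : ∀ᵐ x ∂S.measure, (p + q).snd x = p.snd x + q.snd x := Lp.coeFn_add _ _
    have e1 := integral_add (S.integrable_fst p hψ i) (S.integrable_fst q hψ i)
    have e2 := integral_add (S.integrable_snd p hψ i) (S.integrable_snd q hψ i)
    rw [integral_congr_ae (g := fun x => p.fst x * fderiv ℝ ψ x (EuclideanSpace.single i 1) +
        q.fst x * fderiv ℝ ψ x (EuclideanSpace.single i 1))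
        (by filter_upwards [h1] with x hx; simp only [hx]; ring),
      integral_congr_ae (f := fun x => (p + q).snd x i * ψ x)
        (g := fun x => p.snd x i * ψ x + q.snd x i * ψ x)
        (by filter_upwards [h2] with x hx; simp only [hx, PiLp.add_apply]; ring),
      e1, e2, hp ψ hψ i, hq ψ hψ i]
    ring
  smul_mem' := by
    intro c p hp ψ hψ i
    have h1 : ∀ᵐ x ∂S.measure, (c • p).fst x = c * p.fst x := Lp.coeFn_smul _ _
    have h2 : ∀ᵐ x ∂S.measure, (c • p).snd x = c • p.snd x := Lp.coeFn_smul _ _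
    rw [integral_congr_ae (g := fun x => c * (p.fst x * fderiv ℝ ψ x (EuclideanSpace.single i 1)))
        (by filter_upwards [h1] with x hx; simp only [hx]; ring),
      integral_congr_ae (f := fun x => (c • p).snd x i * ψ x)
        (g := fun x => c * (p.snd x i * ψ x))
        (by filter_upwards [h2] with x hx; simp only [hx, PiLp.smul_apply, smul_eq_mul]; ring),
      integral_const_mul, integral_const_mul, hp ψ hψ i]
    ring

/-- Surface measure on the boundary, the `(d-1)`-dimensional Hausdorff measure. -/
def boundaryMeasure (S : SpatialDomain d) : Measure (E d) :=
  (Measure.hausdorffMeasure ((d : ℝ) - 1)).restrict (frontier S.region)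

/-- `g ∈ L²(∂Ω)` is the trace of `p = (u, ∇u)`: some functions smooth up to the boundary converge
to `u` in `H¹(Ω)` while their boundary values converge to `g` in `L²(∂Ω)`. -/
def HasTrace (S : SpatialDomain d) (p : S.L2Pair) (g : E d → ℝ) : Prop :=
  MemLp g 2 S.boundaryMeasure ∧
  ∃ v : ℕ → E d → ℝ, (∀ n, ContDiff ℝ ∞ (v n)) ∧
    Tendsto (fun n => eLpNorm (fun x => v n x - p.fst x) 2 S.measure) atTop (𝓝 0) ∧
    Tendsto (fun n => eLpNorm (fun x => gradient (v n) x - p.snd x) 2 S.measure) atTop (𝓝 0) ∧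
    Tendsto (fun n => eLpNorm (fun x => v n x - g x) 2 S.boundaryMeasure) atTop (𝓝 0)

theorem continuous_gradient {v : E d → ℝ} (hv : ContDiff ℝ ∞ v) : Continuous (gradient v) :=
  (InnerProductSpace.toDual ℝ (E d)).symm.continuous.comp (hv.continuous_fderiv (by simp))

theorem tendsto_eLpNorm_add {F : Type*} [NormedAddCommGroup F] {μ : Measure (E d)}
    {f g : ℕ → E d → F} (hf : ∀ n, AEStronglyMeasurable (f n) μ)
    (hg : ∀ n, AEStronglyMeasurable (g n) μ)
    (hf0 : Tendsto (fun n => eLpNorm (f n) 2 μ) atTop (𝓝 0))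
    (hg0 : Tendsto (fun n => eLpNorm (g n) 2 μ) atTop (𝓝 0)) :
    Tendsto (fun n => eLpNorm (f n + g n) 2 μ) atTop (𝓝 0) := by
  have h := hf0.add hg0
  rw [add_zero] at h
  exact tendsto_of_tendsto_of_tendsto_of_le_of_le tendsto_const_nhds h (fun _ => zero_le)
    (fun n => eLpNorm_add_le (hf n) (hg n) (by norm_num))

theorem tendsto_eLpNorm_smul {F : Type*} [NormedAddCommGroup F] [NormedSpace ℝ F]
    {μ : Measure (E d)} {f : ℕ → E d → F} (c : ℝ)
    (hf0 : Tendsto (fun n => eLpNorm (f n) 2 μ) atTop (𝓝 0)) :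
    Tendsto (fun n => eLpNorm (c • f n) 2 μ) atTop (𝓝 0) := by
  simp_rw [eLpNorm_const_smul]
  simpa using ENNReal.Tendsto.const_mul hf0 (Or.inr (by simp : ‖c‖ₑ ≠ ⊤))

/-- `H¹₀(Ω)`: the functions in `H¹(Ω)` with zero trace. -/
def H1Zero (S : SpatialDomain d) : Submodule ℝ S.L2Pair where
  carrier := {p | p ∈ S.H1 ∧ S.HasTrace p 0}
  zero_mem' := by
    have h1 : (0 : S.L2Pair).fst =ᵐ[S.measure] 0 := Lp.coeFn_zero _ _ _
    have h2 : (0 : S.L2Pair).snd =ᵐ[S.measure] 0 := Lp.coeFn_zero _ _ _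
    refine ⟨S.H1.zero_mem, MemLp.zero, fun _ _ => 0, fun _ => contDiff_const, ?_, ?_, ?_⟩
    · refine tendsto_const_nhds.congr fun n => ?_
      rw [eLpNorm_congr_ae (g := 0) (by filter_upwards [h1] with x hx; simp only [hx]; simp)]
      simp
    · refine tendsto_const_nhds.congr fun n => ?_
      rw [eLpNorm_congr_ae (g := 0) (by
        filter_upwards [h2] with x hx; simp only [hx]; simp [gradient])]
      simp
    · simp
  add_mem' := by
    rintro p q ⟨hp, -, v, hv, hv1, hv2, hv3⟩ ⟨hq, -, w, hw, hw1, hw2, hw3⟩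
    have h1 : (p + q).fst =ᵐ[S.measure] p.fst + q.fst := Lp.coeFn_add _ _
    have h2 : (p + q).snd =ᵐ[S.measure] p.snd + q.snd := Lp.coeFn_add _ _
    refine ⟨S.H1.add_mem hp hq, MemLp.zero, fun n => v n + w n, fun n => (hv n).add (hw n),
      ?_, ?_, ?_⟩
    · refine (tendsto_eLpNorm_add
        (fun n => (hv n).continuous.aestronglyMeasurable.sub (Lp.aestronglyMeasurable p.fst))
        (fun n => (hw n).continuous.aestronglyMeasurable.sub (Lp.aestronglyMeasurable q.fst))
        hv1 hw1).congr fun n => eLpNorm_congr_ae ?_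
      filter_upwards [h1] with x hx
      simp only [hx, Pi.add_apply, Pi.sub_apply]; ring
    · refine (tendsto_eLpNorm_add
        (fun n => (continuous_gradient (hv n)).aestronglyMeasurable.sub
          (Lp.aestronglyMeasurable p.snd))
        (fun n => (continuous_gradient (hw n)).aestronglyMeasurable.sub
          (Lp.aestronglyMeasurable q.snd))
        hv2 hw2).congr fun n => eLpNorm_congr_ae ?_
      filter_upwards [h2] with x hx
      have e : gradient (v n + w n) x = gradient (v n) x + gradient (w n) x := by
        simp only [gradient]
        rw [fderiv_add ((hv n).differentiable (by simp) x) ((hw n).differentiable (by simp) x),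
          map_add]
      simp only [hx, e, Pi.add_apply, Pi.sub_apply]; abel
    · refine (tendsto_eLpNorm_add
        (fun n => (hv n).continuous.aestronglyMeasurable.sub aestronglyMeasurable_zero)
        (fun n => (hw n).continuous.aestronglyMeasurable.sub aestronglyMeasurable_zero)
        hv3 hw3).congr fun n => eLpNorm_congr_ae (Eventually.of_forall fun x => ?_)
      simp
  smul_mem' := by
    rintro c p ⟨hp, -, v, hv, hv1, hv2, hv3⟩
    have h1 : (c • p).fst =ᵐ[S.measure] c • p.fst := Lp.coeFn_smul _ _
    have h2 : (c • p).snd =ᵐ[S.measure] c • p.snd := Lp.coeFn_smul _ _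
    refine ⟨S.H1.smul_mem c hp, MemLp.zero, fun n => c • v n, fun n => (hv n).const_smul c,
      ?_, ?_, ?_⟩
    · refine (tendsto_eLpNorm_smul c hv1).congr fun n => eLpNorm_congr_ae ?_
      filter_upwards [h1] with x hx
      simp only [hx, Pi.smul_apply, smul_sub]
    · refine (tendsto_eLpNorm_smul c hv2).congr fun n => eLpNorm_congr_ae ?_
      filter_upwards [h2] with x hx
      have e : gradient (c • v n) x = c • gradient (v n) x := by
        simp only [gradient]
        rw [fderiv_const_smul ((hv n).differentiable (by simp) x), map_smul]
      simp only [hx, e, Pi.smul_apply, smul_sub]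
    · refine (tendsto_eLpNorm_smul c hv3).congr fun n =>
        eLpNorm_congr_ae (Eventually.of_forall fun x => ?_)
      simp

end SpatialDomain

/-- The boundary conditions: Dirichlet with prescribed trace `g` or homogeneous Neumann on a
bounded Lipschitz domain, periodic on a flat torus. -/
inductive BoundaryCondition {d : ℕ} : SpatialDomain d → Type
  | dirichlet {Ω : Set (E d)} {hΩ : IsBoundedLipschitzDomain Ω} (g : E d → ℝ) :
      BoundaryCondition (SpatialDomain.lipschitz Ω hΩ)
  | neumann {Ω : Set (E d)} {hΩ : IsBoundedLipschitzDomain Ω} :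
      BoundaryCondition (SpatialDomain.lipschitz Ω hΩ)
  | periodic {b : Module.Basis (Fin d) ℝ (E d)} :
      BoundaryCondition (SpatialDomain.torus b)

namespace BoundaryCondition

variable {d : ℕ}

/-- The admissible functions: those in `H¹` with trace `g` in the Dirichlet case (an empty set
unless `g ∈ H^{1/2}(∂Ω)`), all of `H¹` in the Neumann and periodic cases. -/
def admissible : {S : SpatialDomain d} → BoundaryCondition S → Set S.L2Pair
  | .lipschitz Ω hΩ, dirichlet g =>
    {p | p ∈ (SpatialDomain.lipschitz Ω hΩ).H1 ∧ (SpatialDomain.lipschitz Ω hΩ).HasTrace p g}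
  | .lipschitz Ω hΩ, neumann => (SpatialDomain.lipschitz Ω hΩ).H1
  | .torus b, periodic => (SpatialDomain.torus b).H1

/-- The test functions: `H¹₀` in the Dirichlet case (the direction of the affine admissible
space), `H¹` in the Neumann and periodic cases. -/
def testSpace : {S : SpatialDomain d} → BoundaryCondition S → Submodule ℝ S.L2Pair
  | .lipschitz Ω hΩ, dirichlet _ => (SpatialDomain.lipschitz Ω hΩ).H1Zero
  | .lipschitz Ω hΩ, neumann => (SpatialDomain.lipschitz Ω hΩ).H1
  | .torus b, periodic => (SpatialDomain.torus b).H1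

/-- The space of test functions as a normed space, with the `H¹` norm. -/
def Test {S : SpatialDomain d} (B : BoundaryCondition S) : Type := B.testSpace

instance {S : SpatialDomain d} (B : BoundaryCondition S) : NormedAddCommGroup B.Test :=
  inferInstanceAs (NormedAddCommGroup B.testSpace)

instance {S : SpatialDomain d} (B : BoundaryCondition S) : NormedSpace ℝ B.Test :=
  inferInstanceAs (NormedSpace ℝ B.testSpace)

/-- The pair `(φ, ∇φ)` of a test function. -/
def Test.pair {S : SpatialDomain d} {B : BoundaryCondition S} (φ : B.Test) : S.L2Pair :=
  B.testSpace.subtype φ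

end BoundaryCondition

/-- `f ∈ L²_loc(0,∞; X)`. -/
def LocSqIntegrable {X : Type*} [NormedAddCommGroup X] (f : ℝ → X) : Prop :=
  ∀ a b : ℝ, 0 < a → a ≤ b → MemLp f 2 (volume.restrict (Icc a b))

/-- `σ` is a weak solution, for `t ≥ 0`, of `∂ₜσ = Γ (κ Δσ - W(σ))` with initial value `σ₀` and
boundary condition `B`: `σ ∈ C([0,∞); L²) ∩ L²_loc(0,∞; H¹)` takes admissible values and has a weak
time derivative in `L²_loc(0,∞; (B.Test)*)` satisfying the weak form of the equation. -/
structure IsWeakSolution {d : ℕ} {S : SpatialDomain d} (κ Γ : ℝ) (W : ℝ → ℝ)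
    (B : BoundaryCondition S) (σ₀ : S.L2) (σ : ℝ → S.L2) : Prop where
  continuousOn : ContinuousOn σ (Ici 0)
  initial : σ 0 = σ₀
  /-- `p t = (σ(t), ∇σ(t))`, and `ξ t` is the time derivative `∂ₜσ(t)`. In the weak form the integral
  of `W(σ(t)) φ` is required to converge. -/
  weak_form : ∃ (p : ℝ → S.L2Pair) (ξ : ℝ → (B.Test →L[ℝ] ℝ)),
    LocSqIntegrable p ∧
    (∀ᵐ t ∂(volume.restrict (Ioi (0 : ℝ))), p t ∈ B.admissible ∧ (p t).fst = σ t) ∧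
    LocSqIntegrable ξ ∧
    (∀ a b : ℝ, 0 < a → a ≤ b → ∀ φ : B.Test,
      inner ℝ (σ b) φ.pair.fst - inner ℝ (σ a) φ.pair.fst =
        ∫ t in a..b, ξ t φ) ∧
    (∀ᵐ t ∂(volume.restrict (Ioi (0 : ℝ))), ∀ φ : B.Test,
      Integrable (fun x => W (σ t x) * φ.pair.fst x) S.measure ∧
      ξ t φ = - Γ * (κ * inner ℝ (p t).snd φ.pair.snd +
        ∫ x, W (σ t x) * φ.pair.fst x ∂S.measure))

end LandauFlow

end

/-!
The nonlinearity is monotone up to a linear term: since `a₆ > 0`, the second derivative `V''` is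
bounded below by some `-L`, so `(V'(x) - V'(y)) (x - y) ≥ -L (x - y)²`
(`deriv_landauPotential_one_sided`). Testing the difference of the two equations with
`w = σ₁ - σ₂`, which lies in the test space for almost every time, gives formally
`d/dt ‖w‖² ≤ 2 Γ L ‖w‖²`, hence `‖w t‖² ≤ exp (2 Γ L t) ‖w 0‖²`. This is stronger than the asserted
bound, because the integrand there is at least `1`; no Sobolev embedding is needed, and
`C = 2 Γ L` does not depend on the domain.

The formal step needs care, since `∂ₜw` is only square integrable in time with values in the dual of
the test space, away from `t = 0`. Only an inequality is required. For almost every `t` and all small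
`h > 0` one has `‖w t‖² - ‖w (t - h)‖² ≤ 2 ⟪w t - w (t - h), w t⟫ = 2 ∫ ∂ₜw(s) (w t) ds`, the integral
being over `[t - h, t]`. Divided by `h`, the right-hand side converges to `2 ∂ₜw(t) (w t)` at Lebesgue
points of `∂ₜw`, and by Young's inequality it is at most the average of `‖∂ₜw‖²` plus the squared
`H¹` norm of `w t`. The integrals of these majorants converge, so Fatou's lemma integrates the bound
on the limits (`sub_le_integral_of_backward_slope`, applied in `norm_sq_sub_le_integral`).
Continuity of `w` in `L²` at `t = 0` and Grönwall's inequality conclude (`norm_sq_le_mul_exp`).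
-/

namespace LandauFlow

/-! ### An integrated one-sided derivative estimate -/

theorem _root_.HasDerivAt.tendsto_backward_slope {F : ℝ → ℝ} {F' c : ℝ} (hF : HasDerivAt F F' c) :
    Tendsto (fun h : ℝ => h⁻¹ * (F c - F (c - h))) (𝓝[>] 0) (𝓝 F') := by
  have ht : Tendsto (fun h : ℝ => -h) (𝓝[>] 0) (𝓝[≠] 0) := by
    refine tendsto_nhdsWithin_iff.2 ⟨?_, ?_⟩
    · exact (continuous_neg.tendsto' (0 : ℝ) 0 (by simp)).mono_left nhdsWithin_le_nhds
    · filter_upwards [self_mem_nhdsWithin] with h hh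
      simpa using (ne_of_gt hh : h ≠ 0)
  refine (hF.tendsto_slope_zero.comp ht).congr fun h => ?_
  simp only [Function.comp, smul_eq_mul]
  rw [← sub_eq_add_neg, inv_neg]
  ring

/-- For continuous `P`, the backward difference quotients integrate in the limit to the increment,
although `P` need not be differentiable anywhere. -/
theorem tendsto_average_sub_shift {P : ℝ → ℝ} (hP : Continuous P) (a b : ℝ) :
    Tendsto (fun h : ℝ => ∫ t in a..b, h⁻¹ * (P t - P (t - h))) (𝓝[>] 0) (𝓝 (P b - P a)) := by
  have hI : ∀ x y, IntervalIntegrable P volume x y := fun x y => hP.intervalIntegrable x y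
  have key : ∀ c : ℝ, Tendsto (fun h : ℝ => h⁻¹ * ∫ t in (c - h)..c, P t) (𝓝[>] 0) (𝓝 (P c)) := by
    intro c
    have hd : HasDerivAt (fun x => ∫ t in c..x, P t) (P c) c :=
      intervalIntegral.integral_hasDerivAt_right (hI c c)
        (hP.stronglyMeasurableAtFilter _ _) hP.continuousAt
    refine hd.tendsto_backward_slope.congr fun h => ?_
    rw [intervalIntegral.integral_same, intervalIntegral.integral_symm (c - h) c]
    ring
  refine ((key b).sub (key a)).congr fun h => ?_
  have hs : IntervalIntegrable (fun t => P (t - h)) volume a b :=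
    Continuous.intervalIntegrable (by fun_prop) a b
  rw [intervalIntegral.integral_const_mul, intervalIntegral.integral_sub (hI a b) hs,
    intervalIntegral.integral_comp_sub_right P h, ← mul_sub,
    intervalIntegral.integral_interval_sub_interval_comm (hI _ _) (hI _ _) (hI _ _),
    intervalIntegral.integral_symm (a - h), intervalIntegral.integral_symm a]
  ring

/-- If the backward difference quotients of a continuous `f` are bounded above by the averages of an
integrable function `m` plus an integrable function `k`, then an almost everywhere upper bound `g`
for their limits can be integrated. The majorant rules out singular growth of `f`. -/
theorem sub_le_integral_of_backward_slope {f m k g : ℝ → ℝ} {a b δ : ℝ} (hab : a ≤ b) (hδ : 0 < δ)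
    (hf : Continuous f) (hm : Integrable m) (hk : IntervalIntegrable k volume a b)
    (hg : IntervalIntegrable g volume a b)
    (hmaj : ∀ᵐ t, t ∈ Ioc a b → ∀ h ∈ Ioo 0 δ, f t - f (t - h) ≤ (∫ s in (t - h)..t, m s) + h * k t)
    (hlim : ∀ᵐ t, t ∈ Ioc a b → ∃ (q : ℝ → ℝ) (q₀ : ℝ), Tendsto q (𝓝[>] 0) (𝓝 q₀) ∧ q₀ ≤ g t ∧
      ∀ h ∈ Ioo 0 δ, f t - f (t - h) ≤ h * q h) :
    f b - f a ≤ ∫ t in a..b, g t := by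
  set M : ℝ → ℝ := fun x => ∫ s in (0 : ℝ)..x, m s with hM
  have hmI : ∀ x y, IntervalIntegrable m volume x y := fun x y => hm.intervalIntegrable
  have hMc : Continuous M := intervalIntegral.continuous_primitive hmI 0
  have hMsub : ∀ x y, M y - M x = ∫ s in x..y, m s := fun x y =>
    intervalIntegral.integral_interval_sub_left (hmI _ _) (hmI _ _)
  set P : ℝ → ℝ := fun x => M x - f x with hP
  have hPc : Continuous P := hMc.sub hf
  obtain ⟨u, -, hu0, hut⟩ := exists_seq_strictAnti_tendsto' hδ
  have hun : Tendsto u atTop (𝓝[>] 0) :=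
    tendsto_nhdsWithin_iff.2 ⟨hut, Eventually.of_forall fun n => (hu0 n).1⟩
  -- The excess of the majorant over the difference quotient of `f` with step `u n`.
  set G : ℕ → ℝ → ℝ := fun n t => (u n)⁻¹ * (P t - P (t - u n)) + k t with hG
  have hGi : ∀ n, IntervalIntegrable (G n) volume a b := fun n =>
    (Continuous.intervalIntegrable (by fun_prop) a b).add hk
  have hGnn : ∀ᵐ t, t ∈ Ioc a b → ∀ n, 0 ≤ G n t := by
    filter_upwards [hmaj] with t ht htab n
    have h0 := (hu0 n).1
    have h1 := ht htab _ (hu0 n)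
    rw [← hMsub] at h1
    have h2 : 0 ≤ (u n)⁻¹ * (P t - P (t - u n) + u n * k t) :=
      mul_nonneg (inv_nonneg.2 h0.le) (by simp only [hP]; linarith)
    have h3 : (u n)⁻¹ * (u n * k t) = k t := by field_simp
    simp only [hG]; linarith
  have hGint : Tendsto (fun n => ∫ t in a..b, G n t) atTop
      (𝓝 (P b - P a + ∫ t in a..b, k t)) := by
    refine (((tendsto_average_sub_shift hPc a b).comp hun).add_const (∫ t in a..b, k t)).congr
      fun n => ?_
    simp only [hG, Function.comp]
    rw [← intervalIntegral.integral_add (Continuous.intervalIntegrable (by fun_prop) a b) hk]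
  set μ : Measure ℝ := volume.restrict (Ioc a b) with hμ
  have hGnn' : ∀ᵐ t ∂μ, ∀ n, 0 ≤ G n t := (ae_restrict_iff' measurableSet_Ioc).2 hGnn
  have hGl : ∀ n, ∫⁻ t, ENNReal.ofReal (G n t) ∂μ = ENNReal.ofReal (∫ t in a..b, G n t) := by
    intro n
    rw [intervalIntegral.integral_of_le hab, ofReal_integral_eq_lintegral_ofReal
      ((intervalIntegrable_iff_integrableOn_Ioc_of_le hab).1 (hGi n))
      (hGnn'.mono fun t ht => ht n)]
  set ψ : ℝ → ℝ := fun t => m t + k t - g t with hψ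
  have hψi : Integrable ψ μ := (intervalIntegrable_iff_integrableOn_Ioc_of_le hab).1
    (((hmI a b).add hk).sub hg)
  have hpt : ∀ᵐ t ∂μ, ENNReal.ofReal (ψ t) ≤ liminf (fun n => ENNReal.ofReal (G n t)) atTop := by
    refine (ae_restrict_iff' measurableSet_Ioc).2 ?_
    have hL : LocallyIntegrable m := hm.locallyIntegrable
    filter_upwards [hlim, LocallyIntegrable.ae_hasDerivAt_integral hL] with t ht hd htab
    obtain ⟨q, q₀, hq, hq₀, hle⟩ := ht htab
    have hr : Tendsto (fun n => (u n)⁻¹ * (M t - M (t - u n))) atTop (𝓝 (m t)) :=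
      (hd 0).tendsto_backward_slope.comp hun
    have hlim' : Tendsto (fun n => ENNReal.ofReal
        ((u n)⁻¹ * (M t - M (t - u n)) + k t - q (u n))) atTop
        (𝓝 (ENNReal.ofReal (m t + k t - q₀))) :=
      ENNReal.tendsto_ofReal ((hr.add_const _).sub (hq.comp hun))
    calc ENNReal.ofReal (ψ t) ≤ ENNReal.ofReal (m t + k t - q₀) :=
          ENNReal.ofReal_le_ofReal (by simp only [hψ]; linarith)
      _ = liminf _ atTop := hlim'.liminf_eq.symm
      _ ≤ _ := by
          refine liminf_le_liminf (Eventually.of_forall fun n => ENNReal.ofReal_le_ofReal ?_)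
          have h0 := (hu0 n).1
          have h1 := mul_le_mul_of_nonneg_left (hle _ (hu0 n)) (inv_nonneg.2 h0.le)
          have h3 : (u n)⁻¹ * (u n * q (u n)) = q (u n) := by field_simp
          simp only [hG, hP]
          linarith
  have hR : 0 ≤ P b - P a + ∫ t in a..b, k t :=
    ge_of_tendsto' hGint fun n => by
      rw [intervalIntegral.integral_of_le hab]
      exact integral_nonneg_of_ae (hGnn'.mono fun t ht => ht n)
  -- Fatou's lemma for the nonnegative functions `G n`, whose integrals converge.
  have hF : ∫⁻ t, ENNReal.ofReal (ψ t) ∂μ ≤ ENNReal.ofReal (P b - P a + ∫ t in a..b, k t) :=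
    calc _ ≤ ∫⁻ t, liminf (fun n => ENNReal.ofReal (G n t)) atTop ∂μ := lintegral_mono_ae hpt
      _ ≤ liminf (fun n => ∫⁻ t, ENNReal.ofReal (G n t) ∂μ) atTop :=
          lintegral_liminf_le' fun n =>
            ((intervalIntegrable_iff_integrableOn_Ioc_of_le hab).1
              (hGi n)).aestronglyMeasurable.aemeasurable.ennreal_ofReal
      _ = _ := by
          simp_rw [hGl]
          exact (ENNReal.tendsto_ofReal hGint).liminf_eq
  have hψle : ∫ t, ψ t ∂μ ≤ P b - P a + ∫ t in a..b, k t := by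
    have h1 := ENNReal.toReal_mono ENNReal.ofReal_ne_top hF
    rw [ENNReal.toReal_ofReal hR] at h1
    rw [integral_eq_lintegral_pos_part_sub_lintegral_neg_part hψi]
    have h2 : 0 ≤ (∫⁻ t, ENNReal.ofReal (-ψ t) ∂μ).toReal := ENNReal.toReal_nonneg
    linarith
  rw [← intervalIntegral.integral_of_le hab, hψ,
    intervalIntegral.integral_sub ((hmI a b).add hk) hg,
    intervalIntegral.integral_add (hmI a b) hk, ← hMsub] at hψle
  simp only [hP] at hψle
  linarith

/-- Grönwall's inequality in integral form, without a sign condition on `f`. -/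
theorem le_mul_exp_of_sub_le_integral {f : ℝ → ℝ} {c T : ℝ} (hc : 0 ≤ c) (hT : 0 ≤ T)
    (hf : ContinuousOn f (Icc 0 T))
    (h : ∀ t ∈ Icc 0 T, f t - f 0 ≤ ∫ s in (0 : ℝ)..t, c * f s) :
    f T ≤ f 0 * Real.exp (c * T) := by
  set F : ℝ → ℝ := fun t => f 0 + ∫ s in (0 : ℝ)..t, c * f s with hF
  have hcf : ContinuousOn (fun s => c * f s) (Icc 0 T) := continuousOn_const.mul hf
  have hFc : ContinuousOn F (Icc 0 T) := by
    refine continuousOn_const.add ?_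
    have := intervalIntegral.continuousOn_primitive_interval (μ := volume) (a := 0) (b := T)
      (f := fun s => c * f s) (by rw [uIcc_of_le hT]; exact hcf.integrableOn_Icc)
    rwa [uIcc_of_le hT] at this
  have hd : ∀ t ∈ Ico 0 T, HasDerivWithinAt F (c * f t) (Ici t) t := by
    intro t ht
    have hi : IntervalIntegrable (fun s => c * f s) volume 0 t :=
      (hcf.mono (by rw [uIcc_of_le ht.1]; exact Icc_subset_Icc_right ht.2.le)).intervalIntegrable
    have hmem : Icc 0 T ∈ 𝓝[>] t := mem_of_superset (Ioo_mem_nhdsGT ht.2)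
      fun x hx => ⟨ht.1.trans hx.1.le, hx.2.le⟩
    have h2 : StronglyMeasurableAtFilter (fun s => c * f s) (𝓝[>] t) volume :=
      ⟨_, hmem, hcf.aestronglyMeasurable measurableSet_Icc⟩
    have h3 : ContinuousWithinAt (fun s => c * f s) (Ioi t) t :=
      (hcf t ⟨ht.1, ht.2.le⟩).mono_of_mem_nhdsWithin hmem
    exact (intervalIntegral.integral_hasDerivWithinAt_right hi h2 h3).const_add _
  have key := le_gronwallBound_of_liminf_deriv_right_le (f := F) (f' := fun t => c * f t)
    (δ := f 0) (K := c) (ε := 0) (a := 0) (b := T) hFc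
    (fun t ht r hr => (hd t ht).liminf_right_slope_le hr) (by simp [hF])
    (fun t ht => by
      have := h t ⟨ht.1, ht.2.le⟩
      have h1 : f t ≤ F t := by simp only [hF]; linarith
      have := mul_le_mul_of_nonneg_left h1 hc
      linarith) T ⟨hT, le_rfl⟩
  rw [gronwallBound_ε0, sub_zero] at key
  have := h T ⟨hT, le_rfl⟩
  simp only [hF] at key
  linarith

/-! ### The energy inequality -/

theorem LocSqIntegrable.sub {X : Type*} [NormedAddCommGroup X] {f g : ℝ → X}
    (hf : LocSqIntegrable f) (hg : LocSqIntegrable g) : LocSqIntegrable (fun t => f t - g t) :=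
  fun a b ha hab => (hf a b ha hab).sub (hg a b ha hab)

theorem LocSqIntegrable.integrableOn {X : Type*} [NormedAddCommGroup X] {f : ℝ → X}
    (hf : LocSqIntegrable f) {a b : ℝ} (ha : 0 < a) (hab : a ≤ b) : IntegrableOn f (Icc a b) :=
  (hf a b ha hab).integrable (by norm_num)

theorem LocSqIntegrable.integrableOn_norm_sq {X : Type*} [NormedAddCommGroup X] {f : ℝ → X}
    (hf : LocSqIntegrable f) {a b : ℝ} (ha : 0 < a) (hab : a ≤ b) :
    IntegrableOn (fun t => ‖f t‖ ^ 2) (Icc a b) :=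
  (hf a b ha hab).integrable_norm_pow (by norm_num)

/-- The one-sided half of the Lions–Magenes lemma. The backward increments satisfy
`‖w t‖² - ‖w (t - h)‖² ≤ 2 ⟪w t - w (t - h), w t⟫ = 2 ∫ η s φ ds`, where only the value `φ` of `w`
at the single time `t` enters; its norm is controlled by `k t`. -/
theorem norm_sq_sub_le_integral {H X : Type*} [NormedAddCommGroup H] [InnerProductSpace ℝ H]
    [NormedAddCommGroup X] [NormedSpace ℝ X] {ι : X → H} {w : ℝ → H} {η : ℝ → (X →L[ℝ] ℝ)}
    {k : ℝ → ℝ} {c : ℝ} (hw : ContinuousOn w (Ici 0)) (hη : LocSqIntegrable η)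
    (hk : ∀ a b : ℝ, 0 < a → a ≤ b → IntegrableOn k (Icc a b))
    (hder : ∀ a b : ℝ, 0 < a → a ≤ b → ∀ φ : X,
      inner ℝ (w b) (ι φ) - inner ℝ (w a) (ι φ) = ∫ t in a..b, η t φ)
    (hdiss : ∀ᵐ t ∂(volume.restrict (Ioi (0 : ℝ))),
      ∃ φ : X, ι φ = w t ∧ ‖φ‖ ^ 2 ≤ k t ∧ 2 * η t φ ≤ c * ‖w t‖ ^ 2)
    {a b : ℝ} (ha : 0 < a) (hab : a ≤ b) :
    ‖w b‖ ^ 2 - ‖w a‖ ^ 2 ≤ ∫ t in a..b, c * ‖w t‖ ^ 2 := by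
  have ha2 : 0 < a / 2 := half_pos ha
  have ha2b : a / 2 ≤ b := by linarith
  have hdiss' := (ae_restrict_iff' measurableSet_Ioi).1 hdiss
  set f : ℝ → ℝ := fun t => ‖w (max t (a / 2))‖ ^ 2 with hfdef
  have hf : Continuous f := by
    refine Continuous.pow (Continuous.norm ?_) 2
    exact hw.comp_continuous (by fun_prop) fun x => ha2.le.trans (le_max_right _ _)
  have hfw : ∀ t, a / 2 ≤ t → f t = ‖w t‖ ^ 2 := fun t ht => by
    simp only [hfdef, max_eq_left ht]
  set N : ℝ → (X →L[ℝ] ℝ) := (Icc (a / 2) b).indicator η with hN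
  have hNi : Integrable N :=
    (integrable_indicator_iff measurableSet_Icc).2 (hη.integrableOn ha2 ha2b)
  have hm : Integrable ((Icc (a / 2) b).indicator fun t => ‖η t‖ ^ 2) :=
    (integrable_indicator_iff measurableSet_Icc).2 (hη.integrableOn_norm_sq ha2 ha2b)
  have hki : IntervalIntegrable k volume a b :=
    (intervalIntegrable_iff_integrableOn_Icc_of_le hab).2 (hk a b ha hab)
  have hgi : IntervalIntegrable (fun t => c * ‖w t‖ ^ 2) volume a b := by
    refine ContinuousOn.intervalIntegrable ?_
    rw [uIcc_of_le hab]
    exact continuousOn_const.mul ((hw.mono fun x hx => ha.le.trans hx.1).norm.pow 2)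
  have hsub : ∀ t ∈ Ioc a b, ∀ h ∈ Ioo 0 (a / 2), Icc (t - h) t ⊆ Icc (a / 2) b :=
    fun t ht h hh => Icc_subset_Icc (by linarith [ht.1, hh.2]) ht.2
  -- The basic estimate for backward increments.
  have hincr : ∀ t ∈ Ioc a b, ∀ h ∈ Ioo 0 (a / 2), ∀ φ : X, ι φ = w t →
      f t - f (t - h) ≤ ∫ s in (t - h)..t, 2 * N s φ := by
    intro t ht h hh φ hφ
    have h0 : t - h ≤ t := by linarith [hh.1]
    have h1 : a / 2 < t - h := by linarith [ht.1, hh.2]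
    have e : ∫ s in (t - h)..t, 2 * N s φ = 2 * ∫ s in (t - h)..t, η s φ := by
      rw [← intervalIntegral.integral_const_mul]
      refine intervalIntegral.integral_congr fun s hs => ?_
      rw [uIcc_of_le h0] at hs
      simp only [hN, indicator_of_mem (hsub t ht h hh hs)]
    rw [e, ← hder (t - h) t (ha2.trans h1) h0 φ, hφ, hfw t (by linarith), hfw _ h1.le,
      real_inner_self_eq_norm_sq]
    have := norm_sub_sq_real (w (t - h)) (w t)
    nlinarith [sq_nonneg ‖w (t - h) - w t‖]
  have hNφ : ∀ φ : X, Integrable fun s => N s φ := fun φ =>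
    (ContinuousLinearMap.apply ℝ ℝ φ).integrable_comp hNi
  have key := sub_le_integral_of_backward_slope (g := fun t => c * ‖w t‖ ^ 2) hab ha2 hf hm hki hgi
    ?_ ?_
  · rwa [hfw b ha2b, hfw a (by linarith)] at key
  · filter_upwards [hdiss'] with t ht htab h hh
    -- Young's inequality `2 η φ ≤ ‖η‖² + ‖φ‖²` gives the integrable majorant.
    obtain ⟨φ, hφ, hφk, -⟩ := ht (ha.trans htab.1)
    have h0 : t - h ≤ t := by linarith [hh.1]
    refine (hincr t htab h hh φ hφ).trans ?_
    have e : h * k t = ∫ s in (t - h)..t, k t := by simp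
    rw [e, ← intervalIntegral.integral_add hm.intervalIntegrable
      intervalIntegrable_const]
    refine intervalIntegral.integral_mono_on h0 ((hNφ φ).const_mul 2).intervalIntegrable
      (hm.intervalIntegrable.add intervalIntegrable_const) fun s hs => ?_
    have hs' := hsub t htab h hh hs
    simp only [hN, indicator_of_mem hs']
    have h3 : η s φ ≤ ‖η s‖ * ‖φ‖ := (le_abs_self _).trans ((η s).le_opNorm φ)
    nlinarith [sq_nonneg (‖η s‖ - ‖φ‖)]
  · filter_upwards [hdiss', LocallyIntegrable.ae_hasDerivAt_integral hNi.locallyIntegrable]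
      with t ht hd htab
    -- At a Lebesgue point of `η` the averages of `η · φ` over `[t - h, t]` converge to `η t φ`.
    obtain ⟨φ, hφ, -, hφc⟩ := ht (ha.trans htab.1)
    have hNt : N t = η t := 
      indicator_of_mem (s := Icc (a / 2) b) ⟨by linarith [htab.1], htab.2⟩ η
    refine ⟨fun h => 2 * (h⁻¹ * ∫ s in (t - h)..t, N s φ), 2 * η t φ, ?_, hφc, fun h hh => ?_⟩
    · have hd' : HasDerivAt (fun x => ∫ s in t..x, N s φ) (η t φ) t := by
        have h1 := ((ContinuousLinearMap.apply ℝ ℝ φ).hasFDerivAt).comp_hasDerivAt t (hd t)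
        rw [hNt] at h1
        refine h1.congr_of_eventuallyEq (Eventually.of_forall fun x => ?_)
        exact (ContinuousLinearMap.apply ℝ ℝ φ).intervalIntegral_comp_comm
          hNi.intervalIntegrable
      refine (hd'.tendsto_backward_slope.const_mul 2).congr fun h => ?_
      rw [intervalIntegral.integral_same, intervalIntegral.integral_symm (t - h) t]
      ring
    · refine (hincr t htab h hh φ hφ).trans (le_of_eq ?_)
      have := hh.1.ne'
      rw [intervalIntegral.integral_const_mul]
      field_simp

/-- The energy inequality combined with Grönwall's lemma, down to the initial time `0`, where the
derivative `η` need not be integrable. -/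
theorem norm_sq_le_mul_exp {H X : Type*} [NormedAddCommGroup H] [InnerProductSpace ℝ H]
    [NormedAddCommGroup X] [NormedSpace ℝ X] {ι : X → H} {w : ℝ → H} {η : ℝ → (X →L[ℝ] ℝ)}
    {k : ℝ → ℝ} {c : ℝ} (hc : 0 ≤ c) (hw : ContinuousOn w (Ici 0)) (hη : LocSqIntegrable η)
    (hk : ∀ a b : ℝ, 0 < a → a ≤ b → IntegrableOn k (Icc a b))
    (hder : ∀ a b : ℝ, 0 < a → a ≤ b → ∀ φ : X,
      inner ℝ (w b) (ι φ) - inner ℝ (w a) (ι φ) = ∫ t in a..b, η t φ)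
    (hdiss : ∀ᵐ t ∂(volume.restrict (Ioi (0 : ℝ))),
      ∃ φ : X, ι φ = w t ∧ ‖φ‖ ^ 2 ≤ k t ∧ 2 * η t φ ≤ c * ‖w t‖ ^ 2)
    {T : ℝ} (hT : 0 ≤ T) :
    ‖w T‖ ^ 2 ≤ ‖w 0‖ ^ 2 * Real.exp (c * T) := by
  have hf : ContinuousOn (fun t => ‖w t‖ ^ 2) (Ici 0) := hw.norm.pow 2
  refine le_mul_exp_of_sub_le_integral (f := fun t => ‖w t‖ ^ 2) hc hT
    (hf.mono Icc_subset_Ici_self) fun t ht => ?_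
  rcases ht.1.eq_or_lt with rfl | h0
  · simp
  -- Continuity at time `0` extends the estimate from intervals `[a, t]` with `0 < a`.
  have hlim1 : Tendsto (fun a => ‖w t‖ ^ 2 - ‖w a‖ ^ 2) (𝓝[>] 0)
      (𝓝 (‖w t‖ ^ 2 - ‖w 0‖ ^ 2)) :=
    tendsto_const_nhds.sub ((hf 0 self_mem_Ici).mono Ioi_subset_Ici_self)
  have hint : IntegrableOn (fun s => c * ‖w s‖ ^ 2) (uIcc 0 t) := by
    rw [uIcc_of_le h0.le]
    exact (continuousOn_const.mul (hf.mono Icc_subset_Ici_self)).integrableOn_Icc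
  have hlim2 : Tendsto (fun a => ∫ s in a..t, c * ‖w s‖ ^ 2) (𝓝[>] 0)
      (𝓝 (∫ s in (0 : ℝ)..t, c * ‖w s‖ ^ 2)) := by
    have := intervalIntegral.continuousOn_primitive_interval_left hint 0 (by simp)
    refine Tendsto.mono_left this (nhdsWithin_le_of_mem ?_)
    rw [uIcc_of_le h0.le]
    exact mem_of_superset (Ioo_mem_nhdsGT h0) Ioo_subset_Icc_self
  refine le_of_tendsto_of_tendsto hlim1 hlim2 ?_
  filter_upwards [Ioo_mem_nhdsGT h0] with a ha
  exact norm_sq_sub_le_integral hw hη hk hder hdiss ha.1 ha.2.le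

/-! ### One-sided Lipschitz bound for the nonlinearity -/

theorem deriv_landauPotential (a₂ a₄ a₆ h s : ℝ) :
    deriv (landauPotential a₂ a₄ a₆ h) s = 2 * a₂ * s + 4 * a₄ * s ^ 3 + 6 * a₆ * s ^ 5 - h := by
  have h1 := ((((hasDerivAt_pow 2 s).const_mul a₂).add ((hasDerivAt_pow 4 s).const_mul a₄)).add
    ((hasDerivAt_pow 6 s).const_mul a₆)).sub ((hasDerivAt_id s).const_mul h)
  refine (HasDerivAt.deriv (f := landauPotential a₂ a₄ a₆ h) h1).trans ?_
  norm_num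
  ring

/-- Since `a₆ > 0`, the second derivative `V''` is bounded below; this is the corresponding bound on
difference quotients of `V'`. -/
theorem deriv_landauPotential_one_sided {a₂ a₄ a₆ h : ℝ} (ha₆ : 0 < a₆) (x y : ℝ) :
    -(2 * |a₂| + 4 * a₄ ^ 2 / (3 * a₆)) * (x - y) ^ 2 ≤
      (deriv (landauPotential a₂ a₄ a₆ h) x - deriv (landauPotential a₂ a₄ a₆ h) y) * (x - y) := by
  rw [deriv_landauPotential, deriv_landauPotential]
  set q := x ^ 2 + x * y + y ^ 2 with hq
  set r := x ^ 4 + x ^ 3 * y + x ^ 2 * y ^ 2 + x * y ^ 3 + y ^ 4 with hr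
  have e : (2 * a₂ * x + 4 * a₄ * x ^ 3 + 6 * a₆ * x ^ 5 - h -
      (2 * a₂ * y + 4 * a₄ * y ^ 3 + 6 * a₆ * y ^ 5 - h)) * (x - y) =
      (2 * a₂ + 4 * a₄ * q + 6 * a₆ * r) * (x - y) ^ 2 := by
    simp only [hq, hr]; ring
  rw [e]
  refine mul_le_mul_of_nonneg_right ?_ (sq_nonneg _)
  have h1 : q ^ 2 ≤ 2 * r := by
    simp only [hq, hr]
    nlinarith [sq_nonneg (x ^ 2 - y ^ 2), sq_nonneg (x * y)]
  have h2 : 6 * a₆ * r ≥ 3 * a₆ * q ^ 2 := by nlinarith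
  -- Completing the square in `4 a₄ q + 3 a₆ q²`.
  have h3 : 0 ≤ 4 * a₄ * q + 3 * a₆ * q ^ 2 + 4 * a₄ ^ 2 / (3 * a₆) := by
    have : 4 * a₄ * q + 3 * a₆ * q ^ 2 + 4 * a₄ ^ 2 / (3 * a₆) =
        (3 * a₆ * q + 2 * a₄) ^ 2 / (3 * a₆) := by field_simp; ring
    rw [this]; positivity
  have h4 := neg_abs_le a₂
  linarith

/-! ### Differences of weak solutions -/

theorem SpatialDomain.HasTrace.sub {d : ℕ} {S : SpatialDomain d} {p q : S.L2Pair} {g : E d → ℝ}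
    (hp : S.HasTrace p g) (hq : S.HasTrace q g) : S.HasTrace (p - q) 0 := by
  obtain ⟨hg, v, hv, hv1, hv2, hv3⟩ := hp
  obtain ⟨-, w, hw, hw1, hw2, hw3⟩ := hq
  have h1 : (p - q).fst =ᵐ[S.measure] p.fst - q.fst := Lp.coeFn_sub _ _
  have h2 : (p - q).snd =ᵐ[S.measure] p.snd - q.snd := Lp.coeFn_sub _ _
  have neg : ∀ {F : Type} [NormedAddCommGroup F] [NormedSpace ℝ F] {μ : Measure (E d)}
      {f : ℕ → E d → F}, Tendsto (fun n => eLpNorm (f n) 2 μ) atTop (𝓝 0) →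
      Tendsto (fun n => eLpNorm (-f n) 2 μ) atTop (𝓝 0) := fun h => by simpa only [eLpNorm_neg]
  refine ⟨MemLp.zero, fun n => v n - w n, fun n => (hv n).sub (hw n), ?_, ?_, ?_⟩
  · have m1 : ∀ n, AEStronglyMeasurable (fun x => v n x - p.fst x) S.measure := fun n =>
      (hv n).continuous.aestronglyMeasurable.sub (Lp.aestronglyMeasurable p.fst)
    have m2 : ∀ n, AEStronglyMeasurable (fun x => w n x - q.fst x) S.measure := fun n =>
      (hw n).continuous.aestronglyMeasurable.sub (Lp.aestronglyMeasurable q.fst)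
    refine (tendsto_eLpNorm_add m1 (fun n => (m2 n).neg) hv1 (neg hw1)).congr
      fun n => eLpNorm_congr_ae ?_
    filter_upwards [h1] with x hx
    simp only [hx, Pi.add_apply, Pi.sub_apply, Pi.neg_apply]; ring
  · have m1 : ∀ n, AEStronglyMeasurable (fun x => gradient (v n) x - p.snd x) S.measure := fun n =>
      (continuous_gradient (hv n)).aestronglyMeasurable.sub (Lp.aestronglyMeasurable p.snd)
    have m2 : ∀ n, AEStronglyMeasurable (fun x => gradient (w n) x - q.snd x) S.measure := fun n =>
      (continuous_gradient (hw n)).aestronglyMeasurable.sub (Lp.aestronglyMeasurable q.snd)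
    refine (tendsto_eLpNorm_add m1 (fun n => (m2 n).neg) hv2 (neg hw2)).congr
      fun n => eLpNorm_congr_ae ?_
    filter_upwards [h2] with x hx
    have e : gradient (v n - w n) x = gradient (v n) x - gradient (w n) x := by
      simp only [gradient]
      rw [fderiv_sub ((hv n).differentiable (by simp) x) ((hw n).differentiable (by simp) x),
        map_sub]
    simp only [hx, e, Pi.add_apply, Pi.sub_apply, Pi.neg_apply]; abel
  · have m1 : ∀ n, AEStronglyMeasurable (fun x => v n x - g x) S.boundaryMeasure := fun n =>
      (hv n).continuous.aestronglyMeasurable.sub hg.aestronglyMeasurable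
    have m2 : ∀ n, AEStronglyMeasurable (fun x => w n x - g x) S.boundaryMeasure := fun n =>
      (hw n).continuous.aestronglyMeasurable.sub hg.aestronglyMeasurable
    refine (tendsto_eLpNorm_add m1 (fun n => (m2 n).neg) hv3 (neg hw3)).congr
      fun n => eLpNorm_congr_ae (Eventually.of_forall fun x => ?_)
    simp

theorem BoundaryCondition.sub_mem_testSpace {d : ℕ} {S : SpatialDomain d} (B : BoundaryCondition S)
    {p q : S.L2Pair} (hp : p ∈ B.admissible) (hq : q ∈ B.admissible) : p - q ∈ B.testSpace := by
  cases B with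
  | dirichlet g => exact ⟨Submodule.sub_mem _ hp.1 hq.1, hp.2.sub hq.2⟩
  | neumann => exact Submodule.sub_mem _ hp hq
  | periodic => exact Submodule.sub_mem _ hp hq

/-- If `W` satisfies a one-sided Lipschitz bound, solutions depend Lipschitz continuously on their
initial data in `L²`, with a rate independent of the boundary condition and of the domain. -/
theorem IsWeakSolution.norm_sq_sub_le {d : ℕ} {S : SpatialDomain d} {κ Γ L : ℝ} {W : ℝ → ℝ}
    (hκ : 0 ≤ κ) (hΓ : 0 ≤ Γ) (hL : 0 ≤ L)
    (hW : ∀ x y, -L * (x - y) ^ 2 ≤ (W x - W y) * (x - y)) {B : BoundaryCondition S}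
    {σ₀₁ σ₀₂ : S.L2} {σ₁ σ₂ : ℝ → S.L2} (h₁ : IsWeakSolution κ Γ W B σ₀₁ σ₁)
    (h₂ : IsWeakSolution κ Γ W B σ₀₂ σ₂) {t : ℝ} (ht : 0 ≤ t) :
    ‖σ₁ t - σ₂ t‖ ^ 2 ≤ ‖σ₀₁ - σ₀₂‖ ^ 2 * Real.exp (2 * Γ * L * t) := by
  obtain ⟨p₁, ξ₁, hp₁, had₁, hξ₁, hder₁, heq₁⟩ := h₁.weak_form
  obtain ⟨p₂, ξ₂, hp₂, had₂, hξ₂, hder₂, heq₂⟩ := h₂.weak_form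
  have hev : ∀ {ξ : ℝ → (B.Test →L[ℝ] ℝ)}, LocSqIntegrable ξ → ∀ {a b : ℝ}, 0 < a → a ≤ b →
      ∀ φ : B.Test, IntervalIntegrable (fun t => ξ t φ) volume a b := by
    intro ξ hξ a b ha hab φ
    exact (intervalIntegrable_iff_integrableOn_Icc_of_le hab).2
      ((ContinuousLinearMap.apply ℝ ℝ φ).integrable_comp (hξ.integrableOn ha hab))
  rw [← h₁.initial, ← h₂.initial]
  refine norm_sq_le_mul_exp (X := B.Test) (ι := fun φ => φ.pair.fst) (w := fun t => σ₁ t - σ₂ t)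
    (η := fun t => ξ₁ t - ξ₂ t) (k := fun t => ‖p₁ t - p₂ t‖ ^ 2) (by positivity)
    (h₁.continuousOn.sub h₂.continuousOn) (hξ₁.sub hξ₂)
    (fun a b ha hab => (hp₁.sub hp₂).integrableOn_norm_sq ha hab) ?_ ?_ ht
  · intro a b ha hab φ
    simp only [_root_.sub_apply, inner_sub_left]
    rw [intervalIntegral.integral_sub (hev hξ₁ ha hab φ) (hev hξ₂ ha hab φ),
      ← hder₁ a b ha hab φ, ← hder₂ a b ha hab φ]
    ring
  · filter_upwards [had₁, had₂, heq₁, heq₂] with t ⟨hA₁, hf₁⟩ ⟨hA₂, hf₂⟩ he₁ he₂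
    -- The difference of the two solutions at time `t` lies in the test space.
    let φ : B.Test := (⟨p₁ t - p₂ t, B.sub_mem_testSpace hA₁ hA₂⟩ : B.testSpace)
    have hφ : φ.pair = p₁ t - p₂ t := rfl
    have hφ1 : φ.pair.fst = σ₁ t - σ₂ t := by rw [hφ, ← hf₁, ← hf₂]; rfl
    have hφ2 : φ.pair.snd = (p₁ t).snd - (p₂ t).snd := rfl
    refine ⟨φ, hφ1, le_rfl, ?_⟩
    obtain ⟨hi₁, e₁⟩ := he₁ φ
    obtain ⟨hi₂, e₂⟩ := he₂ φ
    have hsq : ‖σ₁ t - σ₂ t‖ ^ 2 = ∫ x, (φ.pair.fst x) ^ 2 ∂S.measure := by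
      rw [← hφ1, ← real_inner_self_eq_norm_sq, L2.inner_def]
      refine integral_congr_ae (Eventually.of_forall fun x => ?_)
      simp [pow_two]
    have hsqi : Integrable (fun x => (φ.pair.fst x) ^ 2) S.measure :=
      (Lp.memLp φ.pair.fst).integrable_sq
    have hmono : -L * ‖σ₁ t - σ₂ t‖ ^ 2 ≤ (∫ x, W (σ₁ t x) * φ.pair.fst x ∂S.measure) -
        ∫ x, W (σ₂ t x) * φ.pair.fst x ∂S.measure := by
      rw [hsq, ← integral_const_mul, ← integral_sub hi₁ hi₂]
      refine integral_mono_ae (hsqi.const_mul _) (hi₁.sub hi₂) ?_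
      have hx : φ.pair.fst =ᵐ[S.measure] σ₁ t - σ₂ t := by rw [hφ1]; exact Lp.coeFn_sub _ _
      filter_upwards [hx] with x hx
      simp only [hx, Pi.sub_apply]
      have := hW (σ₁ t x) (σ₂ t x)
      linarith
    have hgrad : inner ℝ (p₁ t).snd φ.pair.snd - inner ℝ (p₂ t).snd φ.pair.snd =
        ‖φ.pair.snd‖ ^ 2 := by
      rw [← inner_sub_left, ← hφ2, real_inner_self_eq_norm_sq]
    have hk : 0 ≤ κ * (inner ℝ (p₁ t).snd φ.pair.snd - inner ℝ (p₂ t).snd φ.pair.snd) := by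
      rw [hgrad]; positivity
    simp only [_root_.sub_apply]
    rw [e₁, e₂]
    have := mul_le_mul_of_nonneg_left (add_le_add hk hmono) hΓ
    linarith

end LandauFlow

theorem mainTheorem9 (d : ℕ) (hd₁ : 1 ≤ d) (hd₃ : d ≤ 3)
    (κ Γ a₂ a₄ a₆ h : ℝ) (hκ : 0 < κ) (hΓ : 0 < Γ) (ha₆ : 0 < a₆)
    (S : LandauFlow.SpatialDomain d) :
    (∃ C : ℝ≥0, ∀ (B : LandauFlow.BoundaryCondition S) (σ₀₁ σ₀₂ : S.L2) (σ₁ σ₂ : ℝ → S.L2),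
      LandauFlow.IsWeakSolution κ Γ (deriv (LandauFlow.landauPotential a₂ a₄ a₆ h)) B σ₀₁ σ₁ →
      LandauFlow.IsWeakSolution κ Γ (deriv (LandauFlow.landauPotential a₂ a₄ a₆ h)) B σ₀₂ σ₂ →
      ∀ t : ℝ, 0 ≤ t →
        ENNReal.ofReal (‖σ₁ t - σ₂ t‖ ^ 2) ≤
          EReal.exp (((C : ℝ≥0∞) * ∫⁻ s in Ioc 0 t,
            (1 + eLpNorm (σ₁ s) 6 S.measure ^ 4 + eLpNorm (σ₂ s) 6 S.measure ^ 4) : ℝ≥0∞) :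
              EReal) * ENNReal.ofReal (‖σ₀₁ - σ₀₂‖ ^ 2)) ∧
    (∀ (B : LandauFlow.BoundaryCondition S) (σ₀ : S.L2) (σ₁ σ₂ : ℝ → S.L2),
      LandauFlow.IsWeakSolution κ Γ (deriv (LandauFlow.landauPotential a₂ a₄ a₆ h)) B σ₀ σ₁ →
      LandauFlow.IsWeakSolution κ Γ (deriv (LandauFlow.landauPotential a₂ a₄ a₆ h)) B σ₀ σ₂ →
      ∀ t : ℝ, 0 ≤ t → σ₁ t = σ₂ t) := by
  set L : ℝ := 2 * |a₂| + 4 * a₄ ^ 2 / (3 * a₆) with hLdef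
  have hL : 0 ≤ L := by positivity
  have hW := LandauFlow.deriv_landauPotential_one_sided (a₂ := a₂) (a₄ := a₄) (h := h) ha₆
  rw [← hLdef] at hW
  have hc : 0 ≤ 2 * Γ * L := by positivity
  set C : ℝ≥0 := ⟨2 * Γ * L, hc⟩
  refine ⟨⟨C, fun B σ₀₁ σ₀₂ σ₁ σ₂ h₁ h₂ t ht => ?_⟩,
    fun B σ₀ σ₁ σ₂ h₁ h₂ t ht => ?_⟩
  · have key := h₁.norm_sq_sub_le hκ.le hΓ.le hL hW h₂ ht
    -- The integrand is at least `1`, so the exponent is at least `2 Γ L t`.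
    have hint : ENNReal.ofReal t ≤ ∫⁻ s in Ioc 0 t,
        (1 + eLpNorm (σ₁ s) 6 S.measure ^ 4 + eLpNorm (σ₂ s) 6 S.measure ^ 4) := by
      calc ENNReal.ofReal t = ∫⁻ _ in Ioc 0 t, 1 := by simp
        _ ≤ _ := lintegral_mono fun s => by rw [add_assoc]; exact le_self_add
    have hexp : ENNReal.ofReal (Real.exp (2 * Γ * L * t)) ≤
        EReal.exp (((C : ℝ≥0∞) * ∫⁻ s in Ioc 0 t,
          (1 + eLpNorm (σ₁ s) 6 S.measure ^ 4 + eLpNorm (σ₂ s) 6 S.measure ^ 4) : ℝ≥0∞) :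
            EReal) := by
      rw [← EReal.exp_coe]
      refine EReal.exp_monotone ?_
      have h1 : ((2 * Γ * L * t : ℝ) : EReal) =
          (((C : ℝ≥0∞) * ENNReal.ofReal t : ℝ≥0∞) : EReal) := by
        have h2 : (C : ℝ≥0∞) = ENNReal.ofReal (2 * Γ * L) :=
          (ENNReal.ofReal_eq_coe_nnreal hc).symm
        rw [h2, ← ENNReal.ofReal_mul hc,
          EReal.coe_ennreal_ofReal, max_eq_left (by positivity)]
      rw [h1]
      exact EReal.coe_ennreal_le_coe_ennreal_iff.2 (mul_le_mul_right hint _)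
    calc ENNReal.ofReal (‖σ₁ t - σ₂ t‖ ^ 2)
        ≤ ENNReal.ofReal (Real.exp (2 * Γ * L * t) * ‖σ₀₁ - σ₀₂‖ ^ 2) :=
          ENNReal.ofReal_le_ofReal (by linarith)
      _ = ENNReal.ofReal (Real.exp (2 * Γ * L * t)) * ENNReal.ofReal (‖σ₀₁ - σ₀₂‖ ^ 2) :=
          ENNReal.ofReal_mul (Real.exp_pos _).le
      _ ≤ _ := mul_le_mul_left hexp _
  · have key := h₁.norm_sq_sub_le hκ.le hΓ.le hL hW h₂ ht
    rw [sub_self, norm_zero, zero_pow two_ne_zero, zero_mul] at key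
    exact sub_eq_zero.1 (norm_eq_zero.1 (pow_eq_zero_iff two_ne_zero |>.1
      (le_antisymm key (sq_nonneg _))))
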